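/- Let $G$ be a (finite-dimensional, real, smooth) Lie group and let $N$ and $H$ be closed subgroups of $G$, with their structures of embedded Lie subgroups, $N$ being normal in $G$. Let $\mathfrak n = T_1N$ be the Lie algebra of $N$ and $\mathfrak n^*$ its dual space. For $s\in G$ let $Ad(s):\mathfrak n\to\mathfrak n$ be the differential at the neutral element of the conjugation $y\mapsto sys^{-1}$ of $N$ (that is, the restriction to $\mathfrak n$ of the adjoint action of $G$ on its Lie algebra). Fix $\lambda\in\mathfrak n^*$, and for $h\in H$ let $Ad(h^{-1})^*\lambda\in\mathfrak n^*$ be the functional $X\mapsto\lambda(Ad(h^{-1})X)$. Then the map $\beta_\lambda:H\to\mathfrak n^*$, $h\mapsto Ad(h^{-1})^*\lambda$, is smooth, and it is an immersion at the identity of $H$ (i.e. its differential there has trivial kernel) if and only if the stabilizer $H_\lambda=\{h\in H: Ad(h^{-1})^*\lambda=\lambda\}$ is a discrete subgroup of $H$. -/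

import Mathlib

open scoped Manifold ContDiff

noncomputable section

namespace LieSubgroupPair

theorem mfderiv_comp_at {E E' E'' : Type*} [NormedAddCommGroup E] [NormedSpace ℝ E]
    [NormedAddCommGroup E'] [NormedSpace ℝ E'] [NormedAddCommGroup E''] [NormedSpace ℝ E'']
    {M M' M'' : Type*} [TopologicalSpace M] [ChartedSpace E M] [TopologicalSpace M']
    [ChartedSpace E' M'] [TopologicalSpace M''] [ChartedSpace E'' M'']
    {g : M' → M''} {f : M → M'} {x : M} {y : M'} (hy : f x = y)
    (hg : MDifferentiableAt 𝓘(ℝ, E') 𝓘(ℝ, E'') g y)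
    (hf : MDifferentiableAt 𝓘(ℝ, E) 𝓘(ℝ, E') f x) :
    (mfderiv 𝓘(ℝ, E) 𝓘(ℝ, E'') (g ∘ f) x : E →L[ℝ] E'') =
      (mfderiv 𝓘(ℝ, E') 𝓘(ℝ, E'') g y : E' →L[ℝ] E'').comp
        (mfderiv 𝓘(ℝ, E) 𝓘(ℝ, E') f x : E →L[ℝ] E') := by
  subst hy
  exact mfderiv_comp x hg hf

section Adjoint

variable {EG : Type*} [NormedAddCommGroup EG] [NormedSpace ℝ EG]
  {G : Type*} [TopologicalSpace G] [ChartedSpace EG G] [Group G]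

/-- `Ad s`, the differential at the neutral element of `G` of `y ↦ s * y * s⁻¹`. -/
def Ad (s : G) : GroupLieAlgebra 𝓘(ℝ, EG) G →L[ℝ] GroupLieAlgebra 𝓘(ℝ, EG) G :=
  mfderiv 𝓘(ℝ, EG) 𝓘(ℝ, EG) (fun y : G => s * y * s⁻¹) 1

variable {EN : Type*} [NormedAddCommGroup EN] [NormedSpace ℝ EN]
  (N : Subgroup G) [N.Normal] [ChartedSpace EN N]

/-- The action of `s : G` on the Lie algebra `𝔫 = T₁N` of a normal Lie subgroup `N`: the
differential at the neutral element of the conjugation `N → N`, `y ↦ s * y * s⁻¹`. When `𝔫` is seen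
inside the Lie algebra of `G`, this is the restriction of `Ad s` (see `mfderiv_val_adOn`). -/
def adOn (s : G) : GroupLieAlgebra 𝓘(ℝ, EN) N →L[ℝ] GroupLieAlgebra 𝓘(ℝ, EN) N :=
  mfderiv 𝓘(ℝ, EN) 𝓘(ℝ, EN) (fun y : N => MulAut.conjNormal s y) 1

/-- The dual `𝔫*` of the Lie algebra `𝔫 = T₁N`. The tangent spaces of a manifold modelled on `EN` are
by definition copies of `EN`; the dual is written with `EN`, which carries the norm that turns `𝔫*`
into a manifold. -/
abbrev LieDual (EN : Type*) [NormedAddCommGroup EN] [NormedSpace ℝ EN] {G : Type*} [Group G]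
    [TopologicalSpace G] (N : Subgroup G) [ChartedSpace EN N] : Type _ :=
  EN →L[ℝ] ℝ

/-- The pullback `T^* lam = lam ∘ T` of a linear functional `lam ∈ 𝔫*` by a linear map `T : 𝔫 → 𝔫`. -/
def pullback (T : GroupLieAlgebra 𝓘(ℝ, EN) N →L[ℝ] GroupLieAlgebra 𝓘(ℝ, EN) N)
    (lam : LieDual EN N) : LieDual EN N :=
  ContinuousLinearMap.comp (show GroupLieAlgebra 𝓘(ℝ, EN) N →L[ℝ] ℝ from lam) T

/-- The map `β_λ : H → 𝔫*`, `h ↦ Ad(h⁻¹)^* λ`, that is `β_λ(h)(X) = λ (Ad(h⁻¹) X)`. -/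
def orbitMap (H : Subgroup G) (lam : LieDual EN N) (h : H) : LieDual EN N :=
  pullback N (adOn N ((h : G)⁻¹)) lam

variable {N}

theorem adOn_one : adOn N (1 : G) = ContinuousLinearMap.id ℝ (GroupLieAlgebra 𝓘(ℝ, EN) N) := by
  have e : (fun y : N => MulAut.conjNormal (1 : G) y) = id := by
    ext y
    simp
  unfold adOn
  rw [e]
  exact mfderiv_id

variable [LieGroup 𝓘(ℝ, EG) ∞ G]

theorem contMDiff_conjNormal
    (hN : Manifold.IsSmoothEmbedding 𝓘(ℝ, EN) 𝓘(ℝ, EG) ∞ (Subtype.val : N → G)) (s : G) :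
    ContMDiff 𝓘(ℝ, EN) 𝓘(ℝ, EN) ∞ (fun y : N => MulAut.conjNormal s y) := by
  have h : ContMDiff 𝓘(ℝ, EN) 𝓘(ℝ, EG) ∞
      ((Subtype.val : N → G) ∘ fun y : N => MulAut.conjNormal s y) := by
    have h2 : ContMDiff 𝓘(ℝ, EN) 𝓘(ℝ, EG) ∞ (fun y : N => s * (y : G) * s⁻¹) :=
      (contMDiff_const.mul hN.contMDiff).mul contMDiff_const
    convert h2 using 1
    ext y
    simp
  refine (ContMDiff.iff_comp_isImmersion hN.isImmersion).2 ⟨?_, h⟩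
  exact hN.isEmbedding.continuous_iff.2 h.continuous

/-- `adOn N s` is the restriction of `Ad s` to the Lie algebra of `N`. -/
theorem mfderiv_val_adOn
    (hN : Manifold.IsSmoothEmbedding 𝓘(ℝ, EN) 𝓘(ℝ, EG) ∞ (Subtype.val : N → G)) (s : G)
    (X : GroupLieAlgebra 𝓘(ℝ, EN) N) :
    mfderiv 𝓘(ℝ, EN) 𝓘(ℝ, EG) (Subtype.val : N → G) 1 (adOn N s X) =
      Ad s (mfderiv 𝓘(ℝ, EN) 𝓘(ℝ, EG) (Subtype.val : N → G) 1 X) := by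
  have hv : MDifferentiable 𝓘(ℝ, EN) 𝓘(ℝ, EG) (Subtype.val : N → G) :=
    hN.contMDiff.mdifferentiable (by simp)
  have hc : MDifferentiable 𝓘(ℝ, EN) 𝓘(ℝ, EN) (fun y : N => MulAut.conjNormal s y) :=
    (contMDiff_conjNormal hN s).mdifferentiable (by simp)
  have hg : MDifferentiable 𝓘(ℝ, EG) 𝓘(ℝ, EG) (fun y : G => s * y * s⁻¹) :=
    ContMDiff.mdifferentiable (n := ∞)
      ((contMDiff_const.mul contMDiff_id).mul contMDiff_const) (by simp)
  have e : (Subtype.val : N → G) ∘ (fun y : N => MulAut.conjNormal s y) =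
      (fun y : G => s * y * s⁻¹) ∘ (Subtype.val : N → G) := by
    ext y
    exact MulAut.conjNormal_apply s y
  have h1 := mfderiv_comp_at (y := (1 : N)) (map_one _) (hv 1) (hc 1)
  have h2 := mfderiv_comp_at (show ((1 : N) : G) = 1 from rfl) (hg 1) (hv 1)
  rw [e] at h1
  exact DFunLike.congr_fun (h1.symm.trans h2) X

theorem adOn_mul
    (hN : Manifold.IsSmoothEmbedding 𝓘(ℝ, EN) 𝓘(ℝ, EG) ∞ (Subtype.val : N → G)) (s t : G) :
    adOn (EN := EN) N (s * t) = (adOn N s).comp (adOn N t) := by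
  have hc (s : G) :
      MDifferentiable 𝓘(ℝ, EN) 𝓘(ℝ, EN) (fun y : N => MulAut.conjNormal s y) :=
    (contMDiff_conjNormal hN s).mdifferentiable (by simp)
  have e : (fun y : N => MulAut.conjNormal (s * t) y) =
      (fun y : N => MulAut.conjNormal s y) ∘ (fun y : N => MulAut.conjNormal t y) := by
    ext y
    simp
  unfold adOn
  rw [e]
  exact mfderiv_comp_at (y := (1 : N)) (map_one _) (hc s 1) (hc t 1)

/-- The stabilizer `H_λ = {h ∈ H : Ad(h⁻¹)^* λ = λ}`, a subgroup of `H`. -/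
def stabilizer (hN : Manifold.IsSmoothEmbedding 𝓘(ℝ, EN) 𝓘(ℝ, EG) ∞ (Subtype.val : N → G))
    (H : Subgroup G) (lam : LieDual EN N) : Subgroup H where
  carrier := {h | orbitMap N H lam h = lam}
  one_mem' := by
    change pullback N (adOn N (((1 : H) : G)⁻¹)) lam = lam
    rw [Subgroup.coe_one, inv_one, adOn_one]
    rfl
  mul_mem' := by
    intro a b ha hb
    change pullback N (adOn N ((a : G)⁻¹)) lam = lam at ha
    change pullback N (adOn N ((b : G)⁻¹)) lam = lam at hb
    change pullback N (adOn N (((a * b : H) : G)⁻¹)) lam = lam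
    rw [Subgroup.coe_mul, mul_inv_rev, adOn_mul hN]
    change pullback N (adOn N ((a : G)⁻¹)) (pullback N (adOn N ((b : G)⁻¹)) lam) = lam
    rw [hb, ha]
  inv_mem' := by
    intro a ha
    change pullback N (adOn N ((a : G)⁻¹)) lam = lam at ha
    change pullback N (adOn N (((a⁻¹ : H) : G)⁻¹)) lam = lam
    conv_lhs => rw [← ha]
    change pullback N ((adOn N ((a : G)⁻¹)).comp (adOn N (((a⁻¹ : H) : G)⁻¹))) lam = lam
    rw [← adOn_mul hN, Subgroup.coe_inv, mul_inv_cancel, adOn_one]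
    rfl

end Adjoint

/-- A map between finite-dimensional manifolds is an immersion at `x` if it is smooth near `x` and
its differential at `x` has trivial kernel. -/
def ImmersionAt {E E' : Type*} [NormedAddCommGroup E] [NormedSpace ℝ E]
    [NormedAddCommGroup E'] [NormedSpace ℝ E'] {M M' : Type*}
    [TopologicalSpace M] [ChartedSpace E M] [TopologicalSpace M'] [ChartedSpace E' M']
    (f : M → M') (x : M) : Prop :=
  ContMDiffAt 𝓘(ℝ, E) 𝓘(ℝ, E') ∞ f x ∧
    Function.Injective (mfderiv 𝓘(ℝ, E) 𝓘(ℝ, E') f x)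

end LieSubgroupPair

end

open scoped Manifold ContDiff Topology

noncomputable section

namespace LieSubgroupPair

/-! Since `Ad` is multiplicative, `β(gh) = β(h) ∘ Ad(g⁻¹)`: left translation by `g` acts on the
values of `β` through a linear map of `𝔫*` (`orbitMap_mul`). Hence, if `X` is in the kernel of `dβ`
at `1`, the left-invariant field of `X` is in the kernel everywhere, and `β` is constant along its
integral curve through `1`. That curve stays in `H_λ`; if `H_λ` is discrete, it is stationary near
time `0`, so `X = 0`.

Conversely, an injective differential at `1` isolates `1` in the fibre `H_λ` of `β`, and a subgroup
whose identity is isolated is discrete.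

Smoothness of `β` reduces to that of `s ↦ Ad(s)` on `𝔫`, the derivative at `y = 1` of the jointly
smooth map `(s, y) ↦ s y s⁻¹`. -/

/-- A map from a finite-dimensional manifold to a normed space whose differential at `x` is
injective does not take the value `f x` at other points near `x`. -/
theorem eventually_eq_imp_eq_of_injective_mfderiv {E F : Type*} [NormedAddCommGroup E]
    [NormedSpace ℝ E] [FiniteDimensional ℝ E] [NormedAddCommGroup F] [NormedSpace ℝ F]
    {M : Type*} [TopologicalSpace M] [ChartedSpace E M] {f : M → F} {x : M}
    (hf : MDifferentiableAt 𝓘(ℝ, E) 𝓘(ℝ, F) f x)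
    (hinj : Function.Injective (mfderiv 𝓘(ℝ, E) 𝓘(ℝ, F) f x)) :
    ∀ᶠ z in 𝓝 x, f z = f x → z = x := by
  set L : E →L[ℝ] F := mfderiv 𝓘(ℝ, E) 𝓘(ℝ, F) f x with hL
  have hd : HasFDerivAt (f ∘ (chartAt E x).symm) L (chartAt E x x) := by
    have h : HasFDerivWithinAt (f ∘ (chartAt E x).symm) L (Set.range id) (chartAt E x x) :=
      hf.hasMFDerivAt.2
    rwa [Set.range_id, hasFDerivWithinAt_univ] at h
  -- Finite dimension enters here: it makes an injective linear map bounded below.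
  have hanti : ∃ C, AntilipschitzWith C L := by
    obtain ⟨C, -, hC⟩ := LinearMap.exists_antilipschitzWith (L : E →ₗ[ℝ] F)
      (LinearMap.ker_eq_bot.2 hinj)
    exact ⟨C, hC⟩
  have h1 := eventually_nhdsWithin_iff.1 (hd.eventually_ne (c := f x) hanti)
  have h2 := ((chartAt E x).continuousAt (mem_chart_source E x)).eventually h1
  filter_upwards [h2, (chartAt E x).open_source.mem_nhds (mem_chart_source E x)] with z hz hzs hfz
  by_contra hne
  refine hz (fun h => hne ((chartAt E x).injOn hzs (mem_chart_source E x) h)) ?_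
  simpa [(chartAt E x).left_inv hzs] using hfz

/-- If the differential of `f` vanishes along the velocity of the curve `γ` near `0`, then `f` is
constant along `γ` near `0`. -/
theorem eventually_const_of_mfderiv_eq_zero {E F : Type*} [NormedAddCommGroup E]
    [NormedSpace ℝ E] [NormedAddCommGroup F] [NormedSpace ℝ F]
    {M : Type*} [TopologicalSpace M] [ChartedSpace E M] {f : M → F}
    {v : (x : M) → TangentSpace 𝓘(ℝ, E) x}
    (hf : MDifferentiable 𝓘(ℝ, E) 𝓘(ℝ, F) f) {γ : ℝ → M} {t₀ : ℝ}
    (hγ : IsMIntegralCurveAt (I := 𝓘(ℝ, E)) γ v t₀)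
    (hv : ∀ x, mfderiv 𝓘(ℝ, E) 𝓘(ℝ, F) f x (v x) = 0) :
    ∀ᶠ t in 𝓝 t₀, f (γ t) = f (γ t₀) := by
  obtain ⟨ε, hε, h⟩ := Metric.eventually_nhds_iff_ball.1 hγ
  have hd (t) (ht : t ∈ Metric.ball t₀ ε) : HasFDerivAt (f ∘ γ) (0 : ℝ →L[ℝ] F) t := by
    have h1 := (hf (γ t)).hasMFDerivAt.comp t (h t ht)
    have h2 := h1.hasFDerivAt
    refine h2.congr_fderiv (ContinuousLinearMap.ext_ring ?_)
    exact (congrArg _ (one_smul ℝ (v (γ t)))).trans (hv (γ t))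
  filter_upwards [Metric.ball_mem_nhds t₀ hε] with t ht
  exact (convex_ball t₀ ε).is_const_of_fderivWithin_eq_zero (𝕜 := ℝ)
    (fun s hs => (hd s hs).differentiableAt.differentiableWithinAt)
    (fun s hs => (hd s hs).hasFDerivWithinAt.fderivWithin
      (Metric.isOpen_ball.uniqueDiffWithinAt hs)) ht (Metric.mem_ball_self hε)

section Orbit

variable {EG : Type*} [NormedAddCommGroup EG] [NormedSpace ℝ EG]
  {G : Type*} [TopologicalSpace G] [ChartedSpace EG G] [Group G] [LieGroup 𝓘(ℝ, EG) ∞ G]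
  {EN : Type*} [NormedAddCommGroup EN] [NormedSpace ℝ EN]
  {N : Subgroup G} [N.Normal] [ChartedSpace EN N]

/-- Smoothness is clear in `G`; it descends to `N` because the inclusion is an immersion, once
continuity into `N` is known from the embedding. -/
theorem contMDiff_uncurry_conjNormal
    (hN : Manifold.IsSmoothEmbedding 𝓘(ℝ, EN) 𝓘(ℝ, EG) ∞ (Subtype.val : N → G)) :
    ContMDiff (𝓘(ℝ, EG).prod 𝓘(ℝ, EN)) 𝓘(ℝ, EN) ∞
      (Function.uncurry fun (s : G) (y : N) => MulAut.conjNormal s y) := by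
  have h : ContMDiff (𝓘(ℝ, EG).prod 𝓘(ℝ, EN)) 𝓘(ℝ, EG) ∞
      ((Subtype.val : N → G) ∘ Function.uncurry fun (s : G) (y : N) => MulAut.conjNormal s y) := by
    have h2 : ContMDiff (𝓘(ℝ, EG).prod 𝓘(ℝ, EN)) 𝓘(ℝ, EG) ∞
        (fun p : G × N => p.1 * (p.2 : G) * p.1⁻¹) :=
      (contMDiff_fst.mul (hN.contMDiff.comp contMDiff_snd)).mul contMDiff_fst.inv
    convert h2 using 1
    ext p
    simp [Function.uncurry]
  exact (ContMDiff.iff_comp_isImmersion hN.isImmersion).2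
    ⟨hN.isEmbedding.continuous_iff.2 h.continuous, h⟩

/-- `adOn` as a map to the normed space of continuous linear endomorphisms of the model space. -/
def adOnModel (EN : Type*) [NormedAddCommGroup EN] [NormedSpace ℝ EN]
    (N : Subgroup G) [N.Normal] [ChartedSpace EN N] (s : G) : EN →L[ℝ] EN :=
  adOn (EN := EN) N s

/-- Every conjugation fixes `1`, so the differentials all act on the one fibre `T₁N`, and the
coordinate changes in the parametric derivative are the identity. -/
theorem contMDiff_adOnModel [IsManifold 𝓘(ℝ, EN) ∞ N]
    (hN : Manifold.IsSmoothEmbedding 𝓘(ℝ, EN) 𝓘(ℝ, EG) ∞ (Subtype.val : N → G)) :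
    ContMDiff 𝓘(ℝ, EG) 𝓘(ℝ, EN →L[ℝ] EN) ∞ (adOnModel EN N) := by
  intro s
  have : IsManifold 𝓘(ℝ, EN) 1 N := .of_le (n := ∞) (by simp)
  have h := ContMDiffAt.mfderiv (m := ∞) (x₀ := s)
    (fun (s : G) (y : N) => MulAut.conjNormal s y) (fun _ => 1)
    (contMDiff_uncurry_conjNormal hN _) contMDiffAt_const (by simp)
  refine h.congr_of_eventuallyEq (Filter.Eventually.of_forall fun t => ?_)
  have hs (s : G) : (MulAut.conjNormal s : MulAut N) 1 = 1 := map_one _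
  have hm := mem_chart_source EN (1 : N)
  refine Eq.symm ((inTangentCoordinates_eq _ _ _ ?_ ?_).trans ?_)
  · exact hm
  · simpa only [hs] using hm
  · ext X
    simp only [hs, ContinuousLinearMap.comp_apply]
    rw [(tangentBundleCore 𝓘(ℝ, EN) N).coordChange_self (achart EN 1) 1 hm]
    exact congrArg (adOnModel EN N t)
      ((tangentBundleCore 𝓘(ℝ, EN) N).coordChange_self (achart EN 1) 1 hm X)

theorem orbitMap_mul
    (hN : Manifold.IsSmoothEmbedding 𝓘(ℝ, EN) 𝓘(ℝ, EG) ∞ (Subtype.val : N → G))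
    {H : Subgroup G} (lam : LieDual EN N) (g h : H) :
    orbitMap N H lam (g * h) =
      ContinuousLinearMap.comp (orbitMap N H lam h) (adOnModel EN N ((g : G)⁻¹)) := by
  change pullback N (adOn N (((g * h : H) : G)⁻¹)) lam = _
  rw [Subgroup.coe_mul, mul_inv_rev, adOn_mul hN]
  rfl

variable {EH : Type*} [NormedAddCommGroup EH] [NormedSpace ℝ EH]
  {H : Subgroup G} [ChartedSpace EH H] [LieGroup 𝓘(ℝ, EH) ∞ H]

theorem contMDiff_orbitMap [IsManifold 𝓘(ℝ, EN) ∞ N]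
    (hN : Manifold.IsSmoothEmbedding 𝓘(ℝ, EN) 𝓘(ℝ, EG) ∞ (Subtype.val : N → G))
    (hH : ContMDiff 𝓘(ℝ, EH) 𝓘(ℝ, EG) ∞ (Subtype.val : H → G)) (lam : LieDual EN N) :
    ContMDiff 𝓘(ℝ, EH) 𝓘(ℝ, LieDual EN N) ∞ (orbitMap N H lam) := by
  have h1 : ContMDiff 𝓘(ℝ, EH) 𝓘(ℝ, EN →L[ℝ] EN) ∞
      (fun h : H => adOnModel EN N ((h⁻¹ : H) : G)) :=
    (contMDiff_adOnModel hN).comp (hH.comp (contMDiff_inv 𝓘(ℝ, EH) ∞))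
  exact (ContinuousLinearMap.compL ℝ EN EN ℝ lam).contMDiff.comp h1

/-- The kernel of the differential of the orbit map is invariant under left translations. -/
theorem mfderiv_orbitMap_mulInvariantVectorField [IsManifold 𝓘(ℝ, EN) ∞ N]
    (hN : Manifold.IsSmoothEmbedding 𝓘(ℝ, EN) 𝓘(ℝ, EG) ∞ (Subtype.val : N → G))
    (hH : ContMDiff 𝓘(ℝ, EH) 𝓘(ℝ, EG) ∞ (Subtype.val : H → G)) (lam : LieDual EN N)
    {X : GroupLieAlgebra 𝓘(ℝ, EH) H}
    (hX : mfderiv 𝓘(ℝ, EH) 𝓘(ℝ, LieDual EN N) (orbitMap N H lam) 1 X = 0) (g : H) :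
    mfderiv 𝓘(ℝ, EH) 𝓘(ℝ, LieDual EN N) (orbitMap N H lam) g (mulInvariantVectorField X g) = 0 := by
  have hβ : MDifferentiable 𝓘(ℝ, EH) 𝓘(ℝ, LieDual EN N) (orbitMap N H lam) :=
    (contMDiff_orbitMap hN hH lam).mdifferentiable (by simp)
  have hl : MDifferentiable 𝓘(ℝ, EH) 𝓘(ℝ, EH) (fun h : H => g * h) :=
    (contMDiff_mul_left (n := ∞)).mdifferentiable (by simp)
  -- The chain rule at `1` for `β ∘ L_g = P ∘ β`, with `L_g` left translation, carries the kernel at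
  -- `1` to the kernel at `g`.
  let P : LieDual EN N →L[ℝ] LieDual EN N :=
    (ContinuousLinearMap.compL ℝ EN EN ℝ).flip (adOnModel EN N ((g : G)⁻¹))
  have e : orbitMap N H lam ∘ (fun h : H => g * h) = P ∘ orbitMap N H lam :=
    funext fun h => orbitMap_mul hN lam g h
  have h1 := mfderiv_comp_at (x := (1 : H)) (mul_one g) (hβ g) (hl 1)
  have h2 := mfderiv_comp_at (x := (1 : H)) rfl
    (P.contMDiff.mdifferentiable (n := ∞) (by simp) (orbitMap N H lam 1)) (hβ 1)
  rw [e] at h1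
  have h3 := DFunLike.congr_fun (h1.symm.trans h2) X
  exact h3.trans ((congrArg _ hX).trans
    (map_zero (mfderiv 𝓘(ℝ, LieDual EN N) 𝓘(ℝ, LieDual EN N) P (orbitMap N H lam 1))))

end Orbit

theorem mulInvariantVectorField_one {E : Type*} [NormedAddCommGroup E] [NormedSpace ℝ E]
    {H : Type*} [TopologicalSpace H] [ChartedSpace E H] [Group H]
    (X : GroupLieAlgebra 𝓘(ℝ, E) H) :
    (mulInvariantVectorField X (1 : H) : E) = X := by
  have e : (fun h : H => 1 * h) = id := funext one_mul
  have h : (mfderiv 𝓘(ℝ, E) 𝓘(ℝ, E) (fun h : H => 1 * h) 1 : E →L[ℝ] E) =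
      ContinuousLinearMap.id ℝ E := by
    rw [e]
    exact mfderiv_id
  exact DFunLike.congr_fun h X

end LieSubgroupPair

end

theorem mainTheorem7
    {EG : Type*} [NormedAddCommGroup EG] [NormedSpace ℝ EG] [FiniteDimensional ℝ EG]
    {EN : Type*} [NormedAddCommGroup EN] [NormedSpace ℝ EN] [FiniteDimensional ℝ EN]
    {EH : Type*} [NormedAddCommGroup EH] [NormedSpace ℝ EH] [FiniteDimensional ℝ EH]
    {G : Type*} [TopologicalSpace G] [ChartedSpace EG G] [Group G] [LieGroup 𝓘(ℝ, EG) ∞ G]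
    (N : Subgroup G) [N.Normal] [ChartedSpace EN N] [LieGroup 𝓘(ℝ, EN) ∞ N]
    (hN : Manifold.IsSmoothEmbedding 𝓘(ℝ, EN) 𝓘(ℝ, EG) ∞ (Subtype.val : N → G))
    (H : Subgroup G) [ChartedSpace EH H] [LieGroup 𝓘(ℝ, EH) ∞ H]
    (hH : Manifold.IsSmoothEmbedding 𝓘(ℝ, EH) 𝓘(ℝ, EG) ∞ (Subtype.val : H → G))
    (lam : LieSubgroupPair.LieDual EN N) :
    ContMDiff 𝓘(ℝ, EH) 𝓘(ℝ, LieSubgroupPair.LieDual EN N) ∞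
        (LieSubgroupPair.orbitMap N H lam) ∧
      (LieSubgroupPair.ImmersionAt (E := EH) (E' := LieSubgroupPair.LieDual EN N)
          (LieSubgroupPair.orbitMap N H lam) 1 ↔
        DiscreteTopology (LieSubgroupPair.stabilizer hN H lam)) := by
  have hβ := LieSubgroupPair.contMDiff_orbitMap hN hH.contMDiff lam
  have h1 : LieSubgroupPair.orbitMap N H lam 1 = lam :=
    (LieSubgroupPair.stabilizer hN H lam).one_mem
  have : IsTopologicalGroup H := topologicalGroup_of_lieGroup 𝓘(ℝ, EH) ∞
  refine ⟨hβ, fun himm => ?_, fun hdisc => ⟨hβ 1, ?_⟩⟩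
  · have hev := LieSubgroupPair.eventually_eq_imp_eq_of_injective_mfderiv
      (hβ.mdifferentiable (by simp) 1) himm.2
    rw [h1] at hev
    refine discreteTopology_of_isOpen_singleton_one (isOpen_singleton_iff_nhds_eq_pure _ |>.2 ?_)
    refine le_antisymm ?_ (pure_le_nhds _)
    rw [Filter.le_pure_iff]
    filter_upwards [(continuous_subtype_val.tendsto (1 : LieSubgroupPair.stabilizer hN H lam)).eventually hev] with z hz
    exact Subtype.ext (hz z.2)
  · refine (injective_iff_map_eq_zero _).2 fun X hX => ?_
    have : LieGroup 𝓘(ℝ, EH) (minSmoothness ℝ 3) H :=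
      .of_le (n := ∞) (by simpa using ENat.LEInfty.out)
    have : IsManifold 𝓘(ℝ, EH) 1 H := .of_le (n := ∞) (by simp)
    -- A local integral curve suffices; no one-parameter subgroup is needed.
    obtain ⟨γ, hγ0, hγ⟩ := exists_isMIntegralCurveAt_of_contMDiffAt_boundaryless (t₀ := 0)
      ((contMDiff_mulInvariantVectorField (I := 𝓘(ℝ, EH)) X).contMDiffAt (x := (1 : H)) |>.of_le
        (by simp))
    have hconst := LieSubgroupPair.eventually_const_of_mfderiv_eq_zero
      (hβ.mdifferentiable (by simp)) hγ
      (LieSubgroupPair.mfderiv_orbitMap_mulInvariantVectorField hN hH.contMDiff lam hX)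
    rw [hγ0, h1] at hconst
    -- Near time `0` the curve lies in `H_λ` and, by continuity, in `U`, which meets `H_λ` only in
    -- `1`.
    obtain ⟨U, hU, hU1⟩ := nhds_inter_eq_singleton_of_mem_discrete
      (s := (LieSubgroupPair.stabilizer hN H lam : Set H)) (isDiscrete_iff_discreteTopology.2 hdisc) (LieSubgroupPair.stabilizer hN H lam).one_mem
    have hγd := hγ.self_of_nhds
    have hγ1 : γ =ᶠ[nhds 0] fun _ => 1 := by
      filter_upwards [hconst, hγd.1.eventually (hγ0.symm ▸ hU)] with t ht htU
      exact hU1.subset ⟨htU, ht⟩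
    -- The velocity at time `0` is `X` by the choice of `γ`, and `0` because `γ` is locally constant
    -- there.
    have hz := hasMFDerivAt_unique hγd
      ((hasMFDerivAt_const (1 : H) (0 : ℝ)).congr_of_eventuallyEq hγ1)
    have hz1 : (mulInvariantVectorField X (γ 0) : EH) = 0 :=
      (one_smul ℝ (mulInvariantVectorField X (γ 0))).symm.trans (DFunLike.congr_fun hz (1 : ℝ))
    rw [hγ0, LieSubgroupPair.mulInvariantVectorField_one] at hz1
    exact hz1
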